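/- Let $k\ge 1$ and $d\ge 2$ be integers. In the online $b$-matching problem with variable capacities, a finite nonempty set $S$ of servers with capacities $b_s\in\mathbb{N}$, $b_s\ge 1$, is known in advance. Requests $r\in R$ arrive one by one, each revealing its set of adjacent servers, and must be matched immediately and irrevocably to at most one adjacent server, where each server $s$ is matched at most $b_s$ times. The bipartite graph $G=(S\cup R,E)$ is a $(k,d)$-graph if every server $s$ has degree at least $k b_s$ and every request has degree at most $d$. For $b\ge 1$ put \[ c^*(b)=1-\frac1b\left(\sum_{i=1}^{b} i\binom{kb}{b-i}\frac{1}{(d-1)^{b-i}}\right)\left(1-\frac1d\right)^{kb}, \] and $c^*_s=c^*(b_s)$, $c^*_{\min}=c^*(b_{\min})$ with $b_{\min}=\min_{s\in S} b_s$. For a server $s$ with $b=b_s$ and $c=c^*_s$, define $P_i$ ($0\le i\le b-1$) by \[ \left(\frac{d}{d-1}\right)^{kb-i}\left(P_i+\frac{b-i}{bc}-1\right)=\frac{1}{bc}\sum_{j=1}^{b-i} j\binom{kb-i}{b-i-j}\frac{1}{(d-1)^{b-i-j}}, \] and define $V_s(l,\delta)=1$ for $\delta\ge kb$ and, for $0\le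 l\le b$, $l\le\delta<kb$, \[ V_s(l,\delta)=\sum_{i=l}^{b-1}\frac{(-1)^{i-l}}{(d-1)^{i-l}}\binom{\delta-l}{i-l}\left(\frac{d}{d-1}\right)^{\delta-i}\left(P_i+\frac{b-i}{bc}-1\right)+1-\frac{b-l}{bc}. \] The algorithm WeightedAssignment(VC) leaves a request unmatched if it has no adjacent server with remaining capacity, and otherwise matches it to an adjacent server $s$ with remaining capacity for which $b_s\,(V_s(l_s,\delta_s+1)-V_s(l_s,\delta_s))$ is maximal, where $l_s$ (load) and $\delta_s$ (degree) are the numbers of earlier requests matched to $s$ and adjacent to $s$, respectively. Ties are broken arbitrarily. Theorem. WeightedAssignment(VC) is well defined and always produces a $b$-matching. For every server set and every $(k,d)$-graph $G$ with any order of arrival, its size is at least $(\min_{s\in S}c^*_s)\cdot\mathrm{OPT}(G)$, where $\mathrm{OPT}(G)$ is the maximum size of a $b$-matching in $G$. Moreover $\min_{s\in S}c^*_s=c^*_{\min}$. If $k\ge d$, this ratio is optimal: for every finite nonempty set $B$ of positive integers, every deterministic online algorithm that is $c$-competitive on all $(k,d)$-graphs whose set of server capacities is $B$ satisfies $c\le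 c^*(\min B)$. -/

import Mathlib

namespace KDMatching

noncomputable section

/-! ### Online `b`-matching instances

The servers form a finite type `S`, known in advance together with the capacities `b : S → ℕ`.
A request is given by the finite set of its neighbouring servers, and the sequence of arriving
requests is a list `σ`. So `σ` encodes a bipartite graph on `S` and the set
`R = Fin σ.length` of requests, with an edge between `s` and `t` iff `s ∈ σ[t]`, together with the
order of arrival of the requests. -/

section Instances

variable {S : Type*} [DecidableEq S]

/-- The degree of the server `s` in the graph formed by the requests `σ`. -/
def degree (σ : List (Finset S)) (s : S) : ℕ :=
  (Finset.univ.filter fun t : Fin σ.length => s ∈ σ[t]).card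

/-- `(k,d)`-graphs: each server `s` has degree at least `k * b s`, each request at most `d`. -/
def IsKDGraph (k d : ℕ) (b : S → ℕ) (σ : List (Finset S)) : Prop :=
  (∀ s, k * b s ≤ degree σ s) ∧ ∀ N ∈ σ, N.card ≤ d

/-- A set `M` of server-request pairs is a `b`-matching: it consists of edges, every server `s` lies
on at most `b s` of them, and every request on at most one. -/
def IsBMatching (b : S → ℕ) (σ : List (Finset S)) (M : Finset (S × Fin σ.length)) : Prop :=
  (∀ e ∈ M, e.1 ∈ σ[e.2]) ∧
  (∀ s, (M.filter fun e => e.1 = s).card ≤ b s) ∧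
  (∀ t, (M.filter fun e => e.2 = t).card ≤ 1)

open Classical in
/-- The size of a maximum `b`-matching. -/
def opt [Fintype S] (b : S → ℕ) (σ : List (Finset S)) : ℕ :=
  ((Finset.univ : Finset (Finset (S × Fin σ.length))).filter (IsBMatching b σ)).sup Finset.card

/-- A deterministic online rule for the server set `S`: from the list of earlier requests and the
new request it determines the server to which the new request is matched (`none`: not matched).
The earlier decisions are functions of the earlier requests, so they need not be an argument. -/
abbrev OnlineRule (S : Type*) := List (Finset S) → Finset S → Option S

/-- The set of server-request pairs that the rule `A` selects on the request sequence `σ`. -/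
def OnlineRule.output [Fintype S] (A : OnlineRule S) (σ : List (Finset S)) :
    Finset (S × Fin σ.length) :=
  Finset.univ.filter fun e => A (σ.take e.2) σ[e.2] = some e.1

/-- The load of `s`: the number of requests matched to `s` by `A` after serving `σ`. -/
def OnlineRule.load (A : OnlineRule S) (σ : List (Finset S)) (s : S) : ℕ :=
  (Finset.univ.filter fun t : Fin σ.length => A (σ.take t) σ[t] = some s).card

end Instances

/-- A deterministic online algorithm: for every server set `{0, …, n-1}` with given capacities,
an online rule. -/
abbrev OnlineAlgorithm := (n : ℕ) → (Fin n → ℕ) → OnlineRule (Fin n)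

/-- On every `(k,d)`-graph the algorithm `A` produces a `b`-matching. -/
def OnlineAlgorithm.IsValid (k d : ℕ) (A : OnlineAlgorithm) : Prop :=
  ∀ (n : ℕ) (b : Fin n → ℕ), (∀ s, 0 < b s) → ∀ σ, IsKDGraph k d b σ →
    IsBMatching b σ ((A n b).output σ)

/-- `A` is `c`-competitive on the `(k,d)`-graphs whose set of server capacities is `B`. -/
def OnlineAlgorithm.IsCompetitiveOn (k d : ℕ) (B : Finset ℕ) (c : ℝ) (A : OnlineAlgorithm) :
    Prop :=
  ∀ (n : ℕ) (b : Fin n → ℕ), Finset.univ.image b = B → ∀ σ, IsKDGraph k d b σ →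
    c * (opt b σ : ℝ) ≤ (((A n b).output σ).card : ℝ)

/-! ### The ratio `c*` and the function `V` for a single capacity `b` -/

/-- `c* = 1 - (1/b) (∑_{i=1}^b i C(kb, b-i) / (d-1)^(b-i)) (1 - 1/d)^(kb)`. -/
def cStar (k d b : ℕ) : ℝ :=
  1 - 1 / (b : ℝ) *
    (∑ i ∈ Finset.Icc 1 b, (i : ℝ) * ((k * b).choose (b - i) : ℝ) *
      (1 / ((d : ℝ) - 1) ^ (b - i))) *
    (1 - 1 / (d : ℝ)) ^ (k * b)

/-- The diagonal values `P_l = V(l,l)` for `l < b`, determined by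
`(d/(d-1))^(kb-l) (P_l + (b-l)/(b c*) - 1)
  = 1/(b c*) ∑_{i=1}^{b-l} i C(kb-l, b-l-i) / (d-1)^(b-l-i)`. -/
def P (k d b l : ℕ) : ℝ :=
  1 - ((b : ℝ) - l) / (b * cStar k d b) +
    ((d : ℝ) / (d - 1))⁻¹ ^ (k * b - l) *
      (1 / (b * cStar k d b) *
        ∑ i ∈ Finset.Icc 1 (b - l), (i : ℝ) * ((k * b - l).choose (b - l - i) : ℝ) *
          (1 / ((d : ℝ) - 1) ^ (b - l - i)))

/-- The value `V(l,δ)` of a server of capacity `b` with load `l` and current degree `δ`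
(where `l ≤ b` and `l ≤ δ`). It is `1` for `δ ≥ kb`; the sum is empty and `V(b,δ) = 1` for
`l = b`. -/
def V (k d b l δ : ℕ) : ℝ :=
  if k * b ≤ δ then 1
  else
    (∑ i ∈ Finset.Ico l b,
      (-1 : ℝ) ^ (i - l) * (1 / ((d : ℝ) - 1) ^ (i - l)) * ((δ - l).choose (i - l) : ℝ) *
        ((d : ℝ) / (d - 1)) ^ ((δ : ℤ) - i) *
        (P k d b i + ((b : ℝ) - i) / (b * cStar k d b) - 1)) +
      1 - ((b : ℝ) - l) / (b * cStar k d b)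

/-! ### The algorithm -/

/-- The score `b_s (V_s(l_s, δ_s + 1) - V_s(l_s, δ_s))` of the server `s` after the requests `σ`
have been served by the rule `A`; `V_s` is the function `V` for the capacity `b_s`. -/
def score {S : Type*} [DecidableEq S] (k d : ℕ) (b : S → ℕ) (A : OnlineRule S)
    (σ : List (Finset S)) (s : S) : ℝ :=
  (b s : ℝ) *
    (V k d (b s) (A.load σ s) (degree σ s + 1) - V k d (b s) (A.load σ s) (degree σ s))

/-- The neighbours of the new request `N` that have remaining capacity. -/
def eligible {S : Type*} [DecidableEq S] (b : S → ℕ) (A : OnlineRule S)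
    (σ : List (Finset S)) (N : Finset S) : Finset S :=
  N.filter fun s => A.load σ s < b s

/-- `A` is the algorithm WeightedAssignment(VC), with an arbitrary (deterministic) way of
breaking ties: a request without eligible neighbour is not matched, any other request is
matched to an eligible neighbour of maximum score. -/
def IsWeightedAssignmentVC (k d : ℕ) (A : OnlineAlgorithm) : Prop :=
  ∀ (n : ℕ) (b : Fin n → ℕ) (σ : List (Finset (Fin n))) (N : Finset (Fin n)),
    (eligible b (A n b) σ N = ∅ → A n b σ N = none) ∧
    ((eligible b (A n b) σ N).Nonempty →
      ∃ s ∈ eligible b (A n b) σ N, A n b σ N = some s ∧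
        ∀ s' ∈ eligible b (A n b) σ N,
          score k d b (A n b) σ s' ≤ score k d b (A n b) σ s)

end

end KDMatching

namespace KDMatching

/-! Everything rests on g(m,n) = E[min(m,X)] with X binomial (n, 1/d), which is `gain d m n`: the
expected further load of a server with m free places and n requests to come, each assigned to it
with probability 1/d. Conditioning on one trial gives d g(m+1,n+1) = 1 + g(m,n) + (d-1) g(m+1,n)
(`gain_succ_succ`). The formulas of the statement unfold to b c*(b) = g(b,kb) and V(l,δ) = 1 -
g(b-l,kb-δ)/(b c*) (`mul_cStar`, `V_eq`).

Lower bound on the algorithm: the potential ∑ b_s V_s starts at 0. By the recursion, the increase at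
the matched server plus d-1 times its score is at most 1/c*, and by maximality no other neighbour
rises by more than that score; so the potential stays at most ALG/min c* (`V_match_le`, `sum_V_le`).
At the end all degrees are at least k b_s, so every V_s is 1 and OPT ≤ ∑ b_s ≤ ALG/min c*.

Monotonicity of c* in b: 1 - c*(b) is the mean of a convex function of the average of kb Bernoulli
trials, and such a mean does not increase with the number of trials (`binomialMean_max_le`).

Optimality: the adversary keeps requesting d servers that share capacity, load and degree. By the
same recursion ∑ (load + g(b-l,kb-δ)) never increases; it starts at ∑ b_s c*_s. The servers left
over are boundedly many. For k ≥ d Hall's theorem gives OPT = ∑ b_s, and many servers of the least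
capacity make the error negligible. -/

/-! ### Truncated binomial expectations -/

/-- The expected shortfall `E[(m - X)⁺]` for a binomial variable `X` with `n` trials of success
probability `1 / d`. -/
noncomputable def shortfall (d m n : ℕ) : ℝ :=
  (1 - 1 / (d : ℝ)) ^ n *
    ∑ j ∈ Finset.range m, ((m : ℝ) - j) * (n.choose j : ℝ) * (1 / ((d : ℝ) - 1)) ^ j

/-- The expectation `E[min(m, X)]` for a binomial variable `X` with `n` trials of success
probability `1 / d`. -/
noncomputable def gain (d m n : ℕ) : ℝ := m - shortfall d m n

theorem shortfall_zero_left (d n : ℕ) : shortfall d 0 n = 0 := by simp [shortfall]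

theorem shortfall_zero_right (d m : ℕ) : shortfall d m 0 = m := by
  cases m with
  | zero => simp [shortfall]
  | succ m => simp [shortfall, Finset.sum_range_succ']

/-- Condition on one trial: a success lowers the target by one. On the level of sums this is
Pascal's rule. -/
theorem shortfall_succ_succ {d : ℕ} (hd : 2 ≤ d) (m n : ℕ) :
    shortfall d (m + 1) (n + 1) =
      1 / (d : ℝ) * shortfall d m n + (1 - 1 / (d : ℝ)) * shortfall d (m + 1) n := by
  have hd' : (2 : ℝ) ≤ d := by exact_mod_cast hd
  have h0 : (d : ℝ) ≠ 0 := by linarith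
  have h1 : (d : ℝ) - 1 ≠ 0 := by linarith
  have hp : (1 - 1 / (d : ℝ)) * (1 / ((d : ℝ) - 1)) = 1 / d := by field_simp
  unfold shortfall
  generalize 1 / ((d : ℝ) - 1) = x at *
  have key : ∑ j ∈ Finset.range (m + 1), (((m + 1 : ℕ) : ℝ) - j) * ((n + 1).choose j : ℝ) * x ^ j =
      ∑ j ∈ Finset.range (m + 1), (((m + 1 : ℕ) : ℝ) - j) * (n.choose j : ℝ) * x ^ j +
        x * ∑ j ∈ Finset.range m, ((m : ℝ) - j) * (n.choose j : ℝ) * x ^ j := by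
    rw [Finset.sum_range_succ', Finset.sum_range_succ' _ m, Finset.mul_sum, add_right_comm,
      ← Finset.sum_add_distrib]
    congr 1
    · refine Finset.sum_congr rfl fun j _ => ?_
      rw [Nat.choose_succ_succ]
      push_cast
      ring
    · simp
  rw [key]
  linear_combination ((1 - 1 / (d : ℝ)) ^ n *
    ∑ j ∈ Finset.range m, ((m : ℝ) - j) * (n.choose j : ℝ) * x ^ j) * hp

theorem shortfall_nonneg {d : ℕ} (hd : 2 ≤ d) (m n : ℕ) : 0 ≤ shortfall d m n := by
  have hd' : (2 : ℝ) ≤ d := by exact_mod_cast hd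
  refine mul_nonneg (pow_nonneg ?_ _) (Finset.sum_nonneg fun j hj => ?_)
  · rw [sub_nonneg, div_le_one (by linarith)]
    linarith
  · have : (j : ℝ) ≤ m := by exact_mod_cast (Finset.mem_range.1 hj).le
    have h1 : (0 : ℝ) ≤ 1 / ((d : ℝ) - 1) := by
      apply div_nonneg <;> linarith
    have h2 : (0 : ℝ) ≤ m - j := by linarith
    positivity

theorem one_div_natCast_bounds {d : ℕ} (hd : 2 ≤ d) :
    0 < 1 / (d : ℝ) ∧ 0 < 1 - 1 / (d : ℝ) := by
  have hd' : (2 : ℝ) ≤ d := by exact_mod_cast hd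
  refine ⟨by positivity, ?_⟩
  rw [sub_pos, div_lt_one (by linarith)]
  linarith

theorem shortfall_le_succ_left {d : ℕ} (hd : 2 ≤ d) (m n : ℕ) :
    shortfall d m n ≤ shortfall d (m + 1) n := by
  obtain ⟨h1, h2⟩ := one_div_natCast_bounds hd
  induction n generalizing m with
  | zero => simp [shortfall_zero_right]
  | succ n ih =>
    cases m with
    | zero => simpa [shortfall_zero_left] using shortfall_nonneg hd 1 (n + 1)
    | succ m =>
      rw [shortfall_succ_succ hd, shortfall_succ_succ hd]
      have := mul_le_mul_of_nonneg_left (ih m) h1.le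
      have := mul_le_mul_of_nonneg_left (ih (m + 1)) h2.le
      linarith

theorem gain_zero_left (d n : ℕ) : gain d 0 n = 0 := by simp [gain, shortfall_zero_left]

theorem gain_zero_right (d m : ℕ) : gain d m 0 = 0 := by simp [gain, shortfall_zero_right]

/-- One trial either succeeds, filling a place, or fails. The algorithm and the adversary are both
analysed by this identity. -/
theorem gain_succ_succ {d : ℕ} (hd : 2 ≤ d) (m n : ℕ) :
    (d : ℝ) * gain d (m + 1) (n + 1) = 1 + gain d m n + (d - 1) * gain d (m + 1) n := by
  have h0 : (d : ℝ) ≠ 0 := by positivity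
  simp only [gain, shortfall_succ_succ hd]
  push_cast
  field_simp
  ring

theorem gain_le_succ_right {d : ℕ} (hd : 2 ≤ d) (m n : ℕ) : gain d m n ≤ gain d m (n + 1) := by
  obtain ⟨h1, h2⟩ := one_div_natCast_bounds hd
  cases m with
  | zero => simp [gain_zero_left]
  | succ m =>
    simp only [gain, shortfall_succ_succ hd]
    have := mul_le_mul_of_nonneg_left (shortfall_le_succ_left hd m n) h1.le
    linarith

theorem gain_nonneg {d : ℕ} (hd : 2 ≤ d) (m n : ℕ) : 0 ≤ gain d m n := by
  induction n with
  | zero => simp [gain_zero_right]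
  | succ n ih => exact ih.trans (gain_le_succ_right hd m n)

theorem gain_pos {d : ℕ} (hd : 2 ≤ d) {m n : ℕ} (hm : 0 < m) (hn : 0 < n) : 0 < gain d m n := by
  obtain ⟨m, rfl⟩ := Nat.exists_eq_add_of_lt hm
  obtain ⟨n, rfl⟩ := Nat.exists_eq_add_of_lt hn
  have hd' : (2 : ℝ) ≤ d := by exact_mod_cast hd
  have h := gain_succ_succ hd (0 + m) (0 + n)
  have h1 := gain_nonneg hd (0 + m) (0 + n)
  have h2 := mul_nonneg (by linarith : (0 : ℝ) ≤ d - 1) (gain_nonneg hd (0 + m + 1) (0 + n))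
  exact pos_of_mul_pos_right (by linarith : 0 < (d : ℝ) * _) (by linarith)

theorem sum_Icc_choose_eq (d m n : ℕ) :
    ∑ i ∈ Finset.Icc 1 m, (i : ℝ) * (n.choose (m - i) : ℝ) * (1 / ((d : ℝ) - 1) ^ (m - i)) =
      ∑ j ∈ Finset.range m, ((m : ℝ) - j) * (n.choose j : ℝ) * (1 / ((d : ℝ) - 1)) ^ j := by
  refine Finset.sum_nbij' (fun i => m - i) (fun j => m - j) ?_ ?_ ?_ ?_ ?_
  · intro i hi
    simp only [Finset.mem_Icc, Finset.mem_range] at *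
    omega
  · intro i hi
    simp only [Finset.mem_Icc, Finset.mem_range] at *
    omega
  · intro i hi
    simp only [Finset.mem_Icc] at *
    omega
  · intro i hi
    simp only [Finset.mem_range] at *
    omega
  · intro i hi
    simp only [Finset.mem_Icc] at hi
    rw [Nat.cast_sub hi.2, one_div_pow]
    ring

/-! ### Closed forms of `cStar`, `P` and `V` -/

theorem cStar_eq_one_sub (k d b : ℕ) :
    cStar k d b = 1 - 1 / (b : ℝ) * shortfall d b (k * b) := by
  rw [cStar, sum_Icc_choose_eq, shortfall]
  ring

theorem mul_cStar (k d : ℕ) {b : ℕ} (hb : 0 < b) : (b : ℝ) * cStar k d b = gain d b (k * b) := by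
  rw [cStar_eq_one_sub, gain]
  have : (b : ℝ) ≠ 0 := by positivity
  field_simp

theorem cStar_pos {k d b : ℕ} (hk : 1 ≤ k) (hd : 2 ≤ d) (hb : 0 < b) : 0 < cStar k d b := by
  have h := gain_pos hd hb (Nat.mul_pos hk hb)
  rw [← mul_cStar k d hb] at h
  exact pos_of_mul_pos_right h (by positivity)

theorem P_add_eq {d : ℕ} (hd : 2 ≤ d) (k b l : ℕ) :
    P k d b l + ((b : ℝ) - l) / (b * cStar k d b) - 1 =
      shortfall d (b - l) (k * b - l) / (b * cStar k d b) := by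
  have hd' : (2 : ℝ) ≤ d := by exact_mod_cast hd
  have h0 : (d : ℝ) ≠ 0 := by linarith
  have h1 : ((d : ℝ) / (d - 1))⁻¹ = 1 - 1 / (d : ℝ) := by
    rw [inv_div]
    field_simp
  rw [P, sum_Icc_choose_eq, shortfall, h1]
  ring

/-- A triangular array that vanishes on the row `b` and obeys a linear recursion is determined by
its diagonal. -/
theorem sum_diagonal_eq {b K : ℕ} {x y : ℝ} (hy : y ≠ 0) (f : ℕ → ℕ → ℝ)
    (hf0 : ∀ δ, f b δ = 0)
    (hf : ∀ l δ, l < b → δ < K → f l (δ + 1) = y * f l δ - x * f (l + 1) (δ + 1))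
    (e l : ℕ) (hl : l ≤ b) (hK : l + e ≤ K) :
    ∑ j ∈ Finset.range (b - l), (-1 : ℝ) ^ j * x ^ j * (e.choose j : ℝ) * y ^ ((e : ℤ) - j) *
      f (l + j) (l + j) = f l (l + e) := by
  induction e generalizing l with
  | zero =>
    rcases hl.eq_or_lt with rfl | hl
    · simp [hf0]
    · obtain ⟨m, hm⟩ : ∃ m, b - l = m + 1 := ⟨b - l - 1, by omega⟩
      rw [hm, Finset.sum_range_succ']
      simp
  | succ e ih =>
    rcases hl.eq_or_lt with rfl | hl
    · simp [hf0]
    · obtain ⟨m, hm⟩ : ∃ m, b - l = m + 1 := ⟨b - l - 1, by omega⟩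
      have e1 := ih l hl.le (by omega)
      have e2 := ih (l + 1) hl (by omega)
      -- After the recursion, both inductive hypotheses are sums over the same diagonal values;
      -- Pascal's rule merges their coefficients.
      rw [← add_assoc, hf l (l + e) hl (by omega), ← e1, add_right_comm l e 1, ← e2, hm,
        show b - (l + 1) = m by omega, Finset.sum_range_succ', Finset.sum_range_succ' _ m,
        mul_add, Finset.mul_sum, Finset.mul_sum, add_sub_right_comm, ← Finset.sum_sub_distrib]
      congr 1
      · refine Finset.sum_congr rfl fun j _ => ?_
        rw [Nat.choose_succ_succ, show l + (j + 1) = l + 1 + j by ring,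
          show (((e + 1 : ℕ) : ℤ) - ((j + 1 : ℕ) : ℤ)) = (e : ℤ) - j by push_cast; ring,
          show ((e : ℤ) - ((j + 1 : ℕ) : ℤ)) = (e : ℤ) - j - 1 by push_cast; ring,
          zpow_sub_one₀ hy]
        push_cast
        field_simp
        ring
      · have : y ^ (((e + 1 : ℕ) : ℤ) - ((0 : ℕ) : ℤ)) = y * y ^ ((e : ℤ) - ((0 : ℕ) : ℤ)) := by
          rw [mul_comm, ← zpow_add_one₀ hy]
          congr 1
        rw [this]
        simp [mul_assoc]

/-- The sum in `V` is the solution of a linear recursion with prescribed diagonal, and the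
normalised shortfall satisfies the same recursion with the same diagonal (`P_add_eq`). -/
theorem V_eq {k d b l δ : ℕ} (hd : 2 ≤ d) (hb : 0 < b) (hl : l ≤ b) (hδ : l ≤ δ) :
    V k d b l δ = 1 - gain d (b - l) (k * b - δ) / (b * cStar k d b) := by
  unfold V
  split_ifs with h
  · rw [Nat.sub_eq_zero_of_le h, gain_zero_right]
    simp
  push Not at h
  have hd' : (2 : ℝ) ≤ d := by exact_mod_cast hd
  have h0 : (d : ℝ) ≠ 0 := by linarith
  have h1 : (d : ℝ) - 1 ≠ 0 := by linarith
  -- The required recursion is `shortfall_succ_succ` solved for the term with fewer trials and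
  -- unchanged target.
  have key := sum_diagonal_eq (b := b) (K := k * b) (x := 1 / ((d : ℝ) - 1))
    (y := (d : ℝ) / (d - 1)) (div_ne_zero h0 h1)
    (fun l δ => shortfall d (b - l) (k * b - δ) / (b * cStar k d b))
    (fun δ => by simp [shortfall_zero_left])
    (fun l δ _ _ => by
      obtain ⟨m, hm⟩ : ∃ m, b - l = m + 1 := ⟨b - l - 1, by omega⟩
      obtain ⟨n, hn⟩ : ∃ n, k * b - δ = n + 1 := ⟨k * b - δ - 1, by omega⟩
      rw [hm, hn, show b - (l + 1) = m by omega, show k * b - (δ + 1) = n by omega,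
        shortfall_succ_succ hd]
      field_simp
      ring)
    (δ - l) l hl (by omega)
  rw [Finset.sum_Ico_eq_sum_range]
  have hsum : ∑ i ∈ Finset.range (b - l), (-1 : ℝ) ^ (l + i - l) *
        (1 / ((d : ℝ) - 1) ^ (l + i - l)) * ((δ - l).choose (l + i - l) : ℝ) *
        ((d : ℝ) / (d - 1)) ^ ((δ : ℤ) - ((l + i : ℕ) : ℤ)) *
        (P k d b (l + i) + ((b : ℝ) - ((l + i : ℕ) : ℝ)) / (b * cStar k d b) - 1) =
      shortfall d (b - l) (k * b - δ) / (b * cStar k d b) := by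
    rw [show l + (δ - l) = δ by omega] at key
    rw [← key]
    refine Finset.sum_congr rfl fun i hi => ?_
    have hi := Finset.mem_range.1 hi
    rw [P_add_eq hd, Nat.add_sub_cancel_left, one_div_pow,
      show ((δ : ℤ) - ((l + i : ℕ) : ℤ)) = ((δ - l : ℕ) : ℤ) - i by
        push_cast [Nat.cast_sub hδ]; ring]
  rw [hsum, gain, Nat.cast_sub hl]
  ring

theorem V_zero_zero {k d b : ℕ} (hk : 1 ≤ k) (hd : 2 ≤ d) (hb : 0 < b) : V k d b 0 0 = 0 := by
  have h := (mul_pos (Nat.cast_pos.2 hb) (cStar_pos hk hd hb) : 0 < (b : ℝ) * cStar k d b)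
  rw [V_eq hd hb (Nat.zero_le _) le_rfl, Nat.sub_zero, Nat.sub_zero, ← mul_cStar k d hb,
    div_self h.ne', sub_self]

theorem V_full {k d b δ : ℕ} (hd : 2 ≤ d) (hb : 0 < b) (hδ : b ≤ δ) :
    V k d b b δ = 1 := by
  rw [V_eq hd hb le_rfl hδ, Nat.sub_self, gain_zero_left]
  simp

theorem V_le_succ {k d b l δ : ℕ} (hk : 1 ≤ k) (hd : 2 ≤ d) (hb : 0 < b) (hl : l ≤ b)
    (hδ : l ≤ δ) : V k d b l δ ≤ V k d b l (δ + 1) := by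
  have hc := cStar_pos hk hd hb
  rw [V_eq hd hb hl hδ, V_eq hd hb hl (by omega)]
  have : gain d (b - l) (k * b - (δ + 1)) ≤ gain d (b - l) (k * b - δ) := by
    rcases le_or_gt (k * b) δ with h | h
    · rw [show k * b - (δ + 1) = k * b - δ by omega]
    · rw [show k * b - δ = k * b - (δ + 1) + 1 by omega]
      exact gain_le_succ_right hd _ _
  gcongr

/-- The budget of one request: the matched server, plus d-1 neighbours charged its score. For δ < kb
this is `gain_succ_succ` and holds with equality; from kb on nothing changes. -/
theorem V_match_le {k d b l δ : ℕ} (hk : 1 ≤ k) (hd : 2 ≤ d) (hb : 0 < b) (hl : l < b)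
    (hδ : l ≤ δ) :
    (b : ℝ) * (V k d b (l + 1) (δ + 1) - V k d b l δ) +
      ((d : ℝ) - 1) * (b * (V k d b l (δ + 1) - V k d b l δ)) ≤ 1 / cStar k d b := by
  have hc := cStar_pos hk hd hb
  have hb' : (0 : ℝ) < b := by exact_mod_cast hb
  rw [V_eq hd hb hl.le hδ, V_eq hd hb hl.le (by omega), V_eq hd hb hl (by omega)]
  rcases le_or_gt (k * b) δ with h | h
  · rw [show k * b - (δ + 1) = 0 by omega, show k * b - δ = 0 by omega]
    simp [gain_zero_right, hc.le]
  · obtain ⟨m, hm⟩ : ∃ m, b - l = m + 1 := ⟨b - l - 1, by omega⟩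
    obtain ⟨n, hn⟩ : ∃ n, k * b - δ = n + 1 := ⟨k * b - δ - 1, by omega⟩
    rw [hm, hn, show b - (l + 1) = m by omega, show k * b - (δ + 1) = n by omega]
    have := gain_succ_succ hd m n
    apply le_of_eq
    field_simp
    linear_combination this

/-! ### Monotonicity of `cStar` in the capacity -/

/-- `E[φ(X)]` for a binomial variable `X` with `n` trials of success probability `p`. -/
noncomputable def binomialMean (p : ℝ) (n : ℕ) (φ : ℕ → ℝ) : ℝ :=
  ∑ j ∈ Finset.range (n + 1), (n.choose j : ℝ) * p ^ j * (1 - p) ^ (n - j) * φ j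

/-- Deleting a uniformly random one of n+1 trials leaves n trials; given j successes, the deleted
trial is one of them with probability j/(n+1). At j = 0 the truncated `j - 1` has weight zero. -/
theorem binomialMean_leave_one_out (p : ℝ) (n : ℕ) (φ : ℕ → ℝ) :
    binomialMean p n φ = binomialMean p (n + 1) fun j =>
      (j : ℝ) / (n + 1) * φ (j - 1) + ((n : ℝ) + 1 - j) / (n + 1) * φ j := by
  unfold binomialMean
  have hn : (n : ℝ) + 1 ≠ 0 := by positivity
  simp only [mul_add, Finset.sum_add_distrib]
  have h1 : ∑ j ∈ Finset.range (n + 1 + 1), ((n + 1).choose j : ℝ) * p ^ j *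
      (1 - p) ^ (n + 1 - j) * ((j : ℝ) / (n + 1) * φ (j - 1)) =
      ∑ j ∈ Finset.range (n + 1), (n.choose j : ℝ) * p ^ j * (1 - p) ^ (n - j) * φ j * p := by
    rw [Finset.sum_range_succ']
    simp only [Nat.cast_zero, zero_div, zero_mul, mul_zero, add_zero]
    refine Finset.sum_congr rfl fun j hj => ?_
    have hc : ((n : ℝ) + 1) * (n.choose j : ℝ) = ((n + 1).choose (j + 1) : ℝ) * (j + 1) := by
      exact_mod_cast Nat.add_one_mul_choose_eq n j
    rw [Nat.add_sub_add_right, Nat.add_sub_cancel]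
    push_cast
    field_simp
    linear_combination (-(p ^ (j + 1) * (1 - p) ^ (n - j) * φ j)) * hc
  have h2 : ∑ j ∈ Finset.range (n + 1 + 1), ((n + 1).choose j : ℝ) * p ^ j *
      (1 - p) ^ (n + 1 - j) * (((n : ℝ) + 1 - j) / (n + 1) * φ j) =
      ∑ j ∈ Finset.range (n + 1), (n.choose j : ℝ) * p ^ j * (1 - p) ^ (n - j) * φ j *
        (1 - p) := by
    rw [Finset.sum_range_succ]
    simp only [Nat.cast_add, Nat.cast_one, sub_self, zero_div, zero_mul, mul_zero, add_zero]
    refine Finset.sum_congr rfl fun j hj => ?_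
    have hj : j ≤ n := Nat.lt_succ_iff.1 (Finset.mem_range.1 hj)
    have hc : (n.choose j : ℝ) * (n + 1) = ((n + 1).choose j : ℝ) * ((n : ℝ) + 1 - j) := by
      have := Nat.choose_mul_succ_eq n j
      rw [← Nat.cast_inj (R := ℝ)] at this
      push_cast [Nat.cast_sub (by omega : j ≤ n + 1)] at this
      exact this
    rw [Nat.succ_sub hj, pow_succ]
    field_simp
    linear_combination (-(p ^ j * (1 - p) ^ (n - j) * φ j * (1 - p))) * hc
  rw [h1, h2, ← Finset.sum_add_distrib]
  exact Finset.sum_congr rfl fun j _ => by ring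

/-- Jensen's inequality under the random deletion: the average after deletion has conditional mean
j/(n+1), the average before it. -/
theorem binomialMean_max_le (k : ℕ) {p : ℝ} (hp : 0 ≤ p) (hp1 : p ≤ 1) {n : ℕ} (hn : 0 < n) :
    binomialMean p (n + 1) (fun j => max 0 (1 - (k : ℝ) * j / ((n + 1 : ℕ) : ℝ))) ≤
      binomialMean p n fun j => max 0 (1 - (k : ℝ) * j / n) := by
  rw [binomialMean_leave_one_out p n]
  refine Finset.sum_le_sum fun j hj => ?_
  refine mul_le_mul_of_nonneg_left ?_ ?_
  · have hj : j ≤ n + 1 := Nat.lt_succ_iff.1 (Finset.mem_range.1 hj)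
    have hj' : (j : ℝ) ≤ n + 1 := by exact_mod_cast hj
    have hn' : (0 : ℝ) < n := by exact_mod_cast hn
    have a1 : (0 : ℝ) ≤ (j : ℝ) / (n + 1) := by positivity
    have a2 : (0 : ℝ) ≤ ((n : ℝ) + 1 - j) / (n + 1) := div_nonneg (by linarith) (by positivity)
    refine max_le (add_nonneg (mul_nonneg a1 (le_max_left _ _))
      (mul_nonneg a2 (le_max_left _ _))) ?_
    have b1 := mul_le_mul_of_nonneg_left
      (le_max_right 0 (1 - (k : ℝ) * ((j - 1 : ℕ) : ℝ) / n)) a1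
    have b2 := mul_le_mul_of_nonneg_left (le_max_right 0 (1 - (k : ℝ) * (j : ℝ) / n)) a2
    refine le_trans (le_of_eq ?_) (add_le_add b1 b2)
    cases j with
    | zero => simp; field_simp
    | succ j =>
      rw [Nat.add_sub_cancel]
      push_cast
      field_simp
      ring
  · have : (0 : ℝ) ≤ 1 - p := by linarith
    positivity

theorem shortfall_eq_binomialMean {k d b : ℕ} (hk : 1 ≤ k) (hd : 2 ≤ d) (hb : 0 < b) :
    1 / (b : ℝ) * shortfall d b (k * b) =
      binomialMean (1 / (d : ℝ)) (k * b) fun j => max 0 (1 - (k : ℝ) * j / ((k * b : ℕ) : ℝ)) := by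
  have hb' : (0 : ℝ) < b := by exact_mod_cast hb
  have hk' : (0 : ℝ) < k := by exact_mod_cast hk
  have hd' : (2 : ℝ) ≤ d := by exact_mod_cast hd
  have h0 : (d : ℝ) ≠ 0 := by linarith
  have h1 : (d : ℝ) - 1 ≠ 0 := by linarith
  have hp : (1 - 1 / (d : ℝ)) * (1 / ((d : ℝ) - 1)) = 1 / d := by field_simp
  have hbk : b ≤ k * b + 1 := (Nat.le_mul_of_pos_left b hk).trans (Nat.le_succ _)
  have e : ∀ j : ℕ, 1 - (k : ℝ) * j / ((k * b : ℕ) : ℝ) = 1 / b * (b - j) := fun j => by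
    push_cast
    field_simp
  rw [binomialMean, ← Finset.sum_subset (Finset.range_mono hbk)]
  · rw [shortfall, Finset.mul_sum, Finset.mul_sum]
    refine Finset.sum_congr rfl fun j hj => ?_
    have hj := Finset.mem_range.1 hj
    have hj' : (j : ℝ) ≤ b := by exact_mod_cast hj.le
    have hpj : (1 / (d : ℝ)) ^ j = (1 - 1 / (d : ℝ)) ^ j * (1 / ((d : ℝ) - 1)) ^ j := by
      rw [← mul_pow, hp]
    rw [e, max_eq_right (mul_nonneg (by positivity) (by linarith)), hpj]
    obtain ⟨i, hi⟩ : ∃ i, k * b = j + i :=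
      ⟨k * b - j, by have := Nat.le_mul_of_pos_left b hk; omega⟩
    rw [hi, Nat.add_sub_cancel_left, pow_add]
    ring
  · intro j _ hj
    have hj' : (b : ℝ) ≤ j := by exact_mod_cast not_lt.1 fun h => hj (Finset.mem_range.2 h)
    rw [e, max_eq_left, mul_zero]
    exact mul_nonpos_of_nonneg_of_nonpos (by positivity) (by linarith)

theorem cStar_mono {k d b b' : ℕ} (hk : 1 ≤ k) (hd : 2 ≤ d) (hb : 0 < b) (h : b ≤ b') :
    cStar k d b ≤ cStar k d b' := by
  obtain ⟨h1, h2⟩ := one_div_natCast_bounds hd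
  rw [cStar_eq_one_sub, cStar_eq_one_sub, shortfall_eq_binomialMean hk hd hb,
    shortfall_eq_binomialMean hk hd (hb.trans_le h)]
  refine sub_le_sub_left ?_ _
  have : k * b ≤ k * b' := Nat.mul_le_mul_left k h
  -- With the factor k held fixed, the mean makes sense for any number of trials, so the induction
  -- may pass through non-multiples of k.
  generalize k * b' = n at this
  induction n, this using Nat.le_induction with
  | base => exact le_rfl
  | succ n hn ih =>
    exact (binomialMean_max_le k h1.le (by linarith) ((Nat.mul_pos hk hb).trans_le hn)).trans ih

theorem inf'_cStar {k d : ℕ} (hk : 1 ≤ k) (hd : 2 ≤ d) {n : ℕ} [NeZero n] (b : Fin n → ℕ)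
    (hb : ∀ s, 0 < b s) :
    (Finset.univ.inf' Finset.univ_nonempty fun s => cStar k d (b s)) =
      cStar k d (Finset.univ.inf' Finset.univ_nonempty b) := by
  obtain ⟨s, hs, h⟩ := Finset.exists_mem_eq_inf' Finset.univ_nonempty b
  rw [h]
  refine le_antisymm (Finset.inf'_le _ hs) (Finset.le_inf' _ _ fun t ht => ?_)
  exact cStar_mono hk hd (hb s) (h ▸ Finset.inf'_le b ht)

/-! ### Degrees, loads and output sizes -/

theorem card_filter_take_append {S : Type*} (R : List (Finset S) → Finset S → Prop)
    [∀ σ N, Decidable (R σ N)] (σ : List (Finset S)) (N : Finset S) :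
    (Finset.univ.filter fun t : Fin (σ ++ [N]).length =>
        R ((σ ++ [N]).take t) (σ ++ [N])[t]).card =
      (Finset.univ.filter fun t : Fin σ.length => R (σ.take t) σ[t]).card +
        if R σ N then 1 else 0 := by
  have hlen : (σ ++ [N]).length = σ.length + 1 := by simp
  rw [Finset.card_filter, Finset.card_filter,
    Fintype.sum_equiv (finCongr hlen) _ (fun t : Fin (σ.length + 1) =>
      if R ((σ ++ [N]).take t) ((σ ++ [N])[(t : ℕ)]'(by rw [hlen]; exact t.2)) then 1 else 0)
      (fun t => by simp),
    Fin.sum_univ_castSucc]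
  congr 1
  · refine Finset.sum_congr rfl fun t _ => ?_
    simp [List.take_append_of_le_length t.2.le, List.getElem_append_left]
  · simp

section Lists

variable {S : Type*} [DecidableEq S]

theorem degree_nil (s : S) : degree [] s = 0 := by simp [degree]

theorem degree_append_singleton (σ : List (Finset S)) (N : Finset S) (s : S) :
    degree (σ ++ [N]) s = degree σ s + if s ∈ N then 1 else 0 :=
  card_filter_take_append (fun _ N => s ∈ N) σ N

theorem degree_append (σ τ : List (Finset S)) (s : S) :
    degree (σ ++ τ) s = degree σ s + degree τ s := by
  induction τ using List.reverseRecOn with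
  | nil => simp [degree_nil]
  | append_singleton τ N ih =>
    rw [← List.append_assoc, degree_append_singleton, ih, degree_append_singleton, add_assoc]

variable (A : OnlineRule S)

theorem load_nil (s : S) : A.load [] s = 0 := by simp [OnlineRule.load]

theorem load_append_singleton (σ : List (Finset S)) (N : Finset S) (s : S) :
    A.load (σ ++ [N]) s = A.load σ s + if A σ N = some s then 1 else 0 :=
  card_filter_take_append (fun σ N => A σ N = some s) σ N

theorem load_le_load_append (σ τ : List (Finset S)) (s : S) :
    A.load σ s ≤ A.load (σ ++ τ) s := by
  induction τ using List.reverseRecOn with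
  | nil => simp
  | append_singleton τ N ih =>
    rw [← List.append_assoc, load_append_singleton]
    exact ih.trans (Nat.le_add_right _ _)

variable [Fintype S]

theorem card_output_filter_fst (σ : List (Finset S)) (s : S) :
    ((A.output σ).filter fun e => e.1 = s).card = A.load σ s := by
  unfold OnlineRule.load OnlineRule.output
  refine Finset.card_bij' (fun e _ => e.2) (fun t _ => (s, t)) ?_ ?_ ?_ ?_
  · rintro ⟨s', t⟩ h
    simp only [Finset.mem_filter, Finset.mem_univ, true_and] at h ⊢
    rw [← h.2]
    exact h.1
  · intro t h
    simpa using h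
  · rintro ⟨s', t⟩ h
    simp only [Finset.mem_filter] at h
    rw [← h.2]
  · intro t _
    rfl

theorem card_output (σ : List (Finset S)) : (A.output σ).card = ∑ s, A.load σ s := by
  rw [Finset.card_eq_sum_card_fiberwise (f := Prod.fst) (t := Finset.univ) (fun _ _ => by simp)]
  exact Finset.sum_congr rfl fun s _ => card_output_filter_fst A σ s

theorem opt_le_sum (b : S → ℕ) (σ : List (Finset S)) : opt b σ ≤ ∑ s, b s := by
  classical
  refine Finset.sup_le fun M hM => ?_
  rw [Finset.mem_filter] at hM
  rw [Finset.card_eq_sum_card_fiberwise (f := Prod.fst) (t := Finset.univ) (fun _ _ => by simp)]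
  exact Finset.sum_le_sum fun s _ => hM.2.2.1 s

theorem isBMatching_output {b : S → ℕ} (hA : ∀ σ N s, A σ N = some s → s ∈ N)
    (σ : List (Finset S)) (hb : ∀ s, A.load σ s ≤ b s) : IsBMatching b σ (A.output σ) := by
  refine ⟨fun e he => hA _ _ _ (Finset.mem_filter.1 he).2, fun s => ?_, fun t => ?_⟩
  · rw [card_output_filter_fst]
    exact hb s
  · refine Finset.card_le_one.2 fun e he e' he' => ?_
    obtain ⟨s, u⟩ := e
    obtain ⟨s', u'⟩ := e'
    simp only [OnlineRule.output, Finset.mem_filter, Finset.mem_univ, true_and] at he he'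
    obtain ⟨he, rfl⟩ := he
    obtain ⟨he', rfl⟩ := he'
    rw [he] at he'
    rw [Option.some.inj he']

end Lists

/-! ### The algorithm WeightedAssignment(VC) -/

open Classical in
/-- The choice made for the request `N` after the requests `σ` when the loads are `ld`. -/
noncomputable def weightedChoice {S : Type*} [DecidableEq S] (k d : ℕ) (b : S → ℕ) (ld : S → ℕ)
    (σ : List (Finset S)) (N : Finset S) : Option S :=
  if h : (N.filter fun s => ld s < b s).Nonempty then
    some (Finset.exists_max_image _ (fun s => (b s : ℝ) *
      (V k d (b s) (ld s) (degree σ s + 1) - V k d (b s) (ld s) (degree σ s))) h).choose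
  else none

/-- The loads after the requests `τ.reverse` when all requests are served by `weightedChoice`. -/
noncomputable def weightedLoad {S : Type*} [DecidableEq S] (k d : ℕ) (b : S → ℕ) :
    List (Finset S) → S → ℕ
  | [], _ => 0
  | N :: τ, s => weightedLoad k d b τ s +
      if weightedChoice k d b (weightedLoad k d b τ) τ.reverse N = some s then 1 else 0

/-- The scores refer to the loads of the rule being defined. The circle is broken by first computing
the loads recursively on the reversed request list; `hload` identifies them with the actual loads.
-/
theorem exists_isWeightedAssignmentVC (k d : ℕ) :
    ∃ A : OnlineAlgorithm, IsWeightedAssignmentVC k d A := by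
  let A : OnlineAlgorithm := fun n b σ N =>
    weightedChoice k d b (weightedLoad k d b σ.reverse) σ N
  have hload : ∀ n (b : Fin n → ℕ) σ, (A n b).load σ = weightedLoad k d b σ.reverse := by
    intro n b σ
    induction σ using List.reverseRecOn with
    | nil => ext s; simp [load_nil, weightedLoad]
    | append_singleton σ N ih =>
      ext s
      rw [load_append_singleton, ih, List.reverse_append, List.reverse_singleton,
        List.singleton_append, weightedLoad, List.reverse_reverse]
  refine ⟨A, fun n b σ N => ⟨fun h => ?_, fun h => ?_⟩⟩
  · unfold eligible at h
    rw [hload] at h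
    simp only [A, weightedChoice]
    rw [dif_neg (Finset.not_nonempty_iff_eq_empty.2 h)]
  · unfold eligible score at *
    rw [hload] at *
    have hs := (Finset.exists_max_image _ (fun s => (b s : ℝ) *
      (V k d (b s) (weightedLoad k d b σ.reverse s) (degree σ s + 1) -
        V k d (b s) (weightedLoad k d b σ.reverse s) (degree σ s))) h).choose_spec
    refine ⟨_, hs.1, ?_, hs.2⟩
    simp only [A, weightedChoice]
    rw [dif_pos h]

namespace IsWeightedAssignmentVC

variable {k d : ℕ} {A : OnlineAlgorithm}

theorem mem_eligible (hA : IsWeightedAssignmentVC k d A) {n : ℕ} (b : Fin n → ℕ)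
    {σ : List (Finset (Fin n))} {N : Finset (Fin n)} {s : Fin n}
    (h : A n b σ N = some s) : s ∈ eligible b (A n b) σ N := by
  rcases (eligible b (A n b) σ N).eq_empty_or_nonempty with h0 | h0
  · rw [(hA n b σ N).1 h0] at h
    exact absurd h (by simp)
  · obtain ⟨s', hs', e, -⟩ := (hA n b σ N).2 h0
    rw [e] at h
    rwa [← Option.some.inj h]

theorem load_le (hA : IsWeightedAssignmentVC k d A) {n : ℕ} (b : Fin n → ℕ)
    (σ : List (Finset (Fin n))) (s : Fin n) : (A n b).load σ s ≤ b s := by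
  induction σ using List.reverseRecOn with
  | nil => simp [load_nil]
  | append_singleton σ N ih =>
    rw [load_append_singleton]
    split_ifs with h
    · exact (Finset.mem_filter.1 (hA.mem_eligible b h)).2
    · exact ih

theorem load_le_degree (hA : IsWeightedAssignmentVC k d A) {n : ℕ} (b : Fin n → ℕ)
    (σ : List (Finset (Fin n))) (s : Fin n) :
    (A n b).load σ s ≤ degree σ s := by
  induction σ using List.reverseRecOn with
  | nil => simp [load_nil]
  | append_singleton σ N ih =>
    rw [load_append_singleton, degree_append_singleton]
    split_ifs with h h' h'
    · omega
    · exact absurd (Finset.mem_filter.1 (hA.mem_eligible b h)).1 h'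
    · omega
    · omega

theorem isValid (hA : IsWeightedAssignmentVC k d A) : A.IsValid k d := fun _ b _ σ _ =>
  isBMatching_output _ (fun _ _ _ h => (Finset.mem_filter.1 (hA.mem_eligible b h)).1) σ
    (hA.load_le b σ)

theorem sum_V_le (hA : IsWeightedAssignmentVC k d A) {n : ℕ} (b : Fin n → ℕ)
    (hk : 1 ≤ k) (hd : 2 ≤ d) (hb : ∀ s, 0 < b s) {c : ℝ} (hc : 0 < c)
    (hcb : ∀ s, c ≤ cStar k d (b s)) (σ : List (Finset (Fin n))) (hσ : ∀ N ∈ σ, N.card ≤ d) :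
    ∑ s, (b s : ℝ) * V k d (b s) ((A n b).load σ s) (degree σ s) ≤
      (∑ s, ((A n b).load σ s : ℝ)) * (1 / c) := by
  induction σ using List.reverseRecOn with
  | nil => simp [load_nil, degree_nil, V_zero_zero hk hd (hb _)]
  | append_singleton σ N ih =>
    have ih := ih fun N hN => hσ N (by simp [hN])
    have hN : N.card ≤ d := hσ N (by simp)
    have hl := hA.load_le b σ
    have hld := hA.load_le_degree b σ
    -- A full server already has V = 1, so ineligible neighbours do not change the potential.
    have hscore : ∀ s ∈ N, s ∉ eligible b (A n b) σ N →
        V k d (b s) ((A n b).load σ s) (degree σ s) = 1 ∧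
        V k d (b s) ((A n b).load σ s) (degree σ s + 1) = 1 := by
      intro s hs hs'
      have e : (A n b).load σ s = b s := by
        refine le_antisymm (hl s) (not_lt.1 fun h => hs' (Finset.mem_filter.2 ⟨hs, h⟩))
      have := hld s
      rw [e] at this ⊢
      exact ⟨V_full hd (hb s) this, V_full hd (hb s) (by omega)⟩
    have hpos : ∀ s, 0 ≤ score k d b (A n b) σ s := fun s =>
      mul_nonneg (Nat.cast_nonneg _) (sub_nonneg.2 (V_le_succ hk hd (hb s) (hl s) (hld s)))
    rcases (eligible b (A n b) σ N).eq_empty_or_nonempty with h0 | h0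
    · have e := (hA n b σ N).1 h0
      simp only [load_append_singleton, e, reduceCtorEq, if_false, add_zero]
      refine le_trans (le_of_eq (Finset.sum_congr rfl fun s _ => ?_)) ih
      rw [degree_append_singleton]
      split_ifs with hs
      · obtain ⟨h1, h2⟩ := hscore s hs (by simp [h0])
        rw [h1, h2]
      · rfl
    · obtain ⟨s₀, hs₀, e, hmax⟩ := (hA n b σ N).2 h0
      obtain ⟨hs₀N, hs₀l⟩ := Finset.mem_filter.1 hs₀
      have hmax' : ∀ s ∈ N, score k d b (A n b) σ s ≤ score k d b (A n b) σ s₀ := by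
        intro s hs
        by_cases hs' : s ∈ eligible b (A n b) σ N
        · exact hmax s hs'
        · obtain ⟨h1, h2⟩ := hscore s hs hs'
          refine le_trans (le_of_eq ?_) (hpos s₀)
          rw [score, h1, h2, sub_self, mul_zero]
      have hload : ∀ s, (A n b).load (σ ++ [N]) s =
          (A n b).load σ s + if s = s₀ then 1 else 0 := fun s => by
        rw [load_append_singleton, e]
        simp only [Option.some.injEq, eq_comm]
      have hsum : ∑ s, ((A n b).load (σ ++ [N]) s : ℝ) = ∑ s, ((A n b).load σ s : ℝ) + 1 := by
        simp [hload, Finset.sum_add_distrib]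
      have hterm : ∀ s, (b s : ℝ) *
          V k d (b s) ((A n b).load (σ ++ [N]) s) (degree (σ ++ [N]) s) =
          b s * V k d (b s) ((A n b).load σ s) (degree σ s) +
          ((if s = s₀ then (b s₀ : ℝ) * (V k d (b s₀) ((A n b).load σ s₀ + 1) (degree σ s₀ + 1) -
              V k d (b s₀) ((A n b).load σ s₀) (degree σ s₀)) else 0) +
            if s ∈ N.erase s₀ then score k d b (A n b) σ s else 0) := by
        intro s
        rw [hload, degree_append_singleton]
        by_cases h1 : s = s₀
        · subst h1
          simp [hs₀N]
          ring
        · by_cases h2 : s ∈ N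
          · simp [h1, h2, score]
            ring
          · simp [h1, h2]
      rw [hsum, Finset.sum_congr rfl fun s _ => hterm s, Finset.sum_add_distrib,
        Finset.sum_add_distrib, Finset.sum_ite_eq' Finset.univ s₀, if_pos (Finset.mem_univ _),
        ← Finset.sum_filter, Finset.filter_mem_eq_inter, Finset.univ_inter]
      -- At most d-1 other neighbours, each scoring no more than the chosen server.
      have h1 : ∑ s ∈ N.erase s₀, score k d b (A n b) σ s ≤
          ((d : ℝ) - 1) * score k d b (A n b) σ s₀ := by
        refine (Finset.sum_le_card_nsmul _ _ _ fun s hs =>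
          hmax' s (Finset.mem_of_mem_erase hs)).trans ?_
        rw [nsmul_eq_mul, Finset.card_erase_of_mem hs₀N]
        refine mul_le_mul_of_nonneg_right ?_ (hpos s₀)
        rw [Nat.cast_sub (Finset.card_pos.2 ⟨s₀, hs₀N⟩)]
        have : (N.card : ℝ) ≤ d := by exact_mod_cast hN
        push_cast
        linarith
      have h2 := V_match_le hk hd (hb s₀) hs₀l (hld s₀)
      have h3 : 1 / cStar k d (b s₀) ≤ 1 / c := one_div_le_one_div_of_le hc (hcb s₀)
      unfold score at h1
      unfold score
      linarith

theorem competitive (hA : IsWeightedAssignmentVC k d A) {n : ℕ} (b : Fin n → ℕ)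
    (hk : 1 ≤ k) (hd : 2 ≤ d) [NeZero n] (hb : ∀ s, 0 < b s)
    {σ : List (Finset (Fin n))} (hσ : IsKDGraph k d b σ) :
    (Finset.univ.inf' Finset.univ_nonempty fun s => cStar k d (b s)) * (opt b σ : ℝ) ≤
      (((A n b).output σ).card : ℝ) := by
  set c := Finset.univ.inf' Finset.univ_nonempty fun s => cStar k d (b s) with hcdef
  have hc : 0 < c := (Finset.lt_inf'_iff _).2 fun s _ => cStar_pos hk hd (hb s)
  have h := hA.sum_V_le b hk hd hb hc (fun s => Finset.inf'_le _ (Finset.mem_univ s)) σ hσ.2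
  have hV : ∀ s, V k d (b s) ((A n b).load σ s) (degree σ s) = 1 := fun s => if_pos (hσ.1 s)
  have hopt : (opt b σ : ℝ) ≤ ∑ s, (b s : ℝ) := by exact_mod_cast opt_le_sum b σ
  simp only [hV, mul_one] at h
  rw [card_output, Nat.cast_sum]
  calc c * (opt b σ : ℝ) ≤ c * ((∑ s, ((A n b).load σ s : ℝ)) * (1 / c)) :=
        mul_le_mul_of_nonneg_left (hopt.trans h) hc.le
    _ = _ := by field_simp

end IsWeightedAssignmentVC

/-! ### Optimality -/

section MaximumMatching

variable {S : Type*} [DecidableEq S]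

theorem mul_sum_le_mul_card_of_isKDGraph {k d : ℕ} {b : S → ℕ} {σ : List (Finset S)}
    (hσ : IsKDGraph k d b σ) (T : Finset S) :
    k * ∑ s ∈ T, b s ≤
      d * (Finset.univ.filter fun t : Fin σ.length => ∃ s ∈ T, s ∈ σ[t]).card := by
  calc k * ∑ s ∈ T, b s = ∑ s ∈ T, k * b s := Finset.mul_sum _ _ _
    _ ≤ ∑ s ∈ T, degree σ s := Finset.sum_le_sum fun s _ => hσ.1 s
    _ = ∑ t : Fin σ.length, (T.filter fun s => s ∈ σ[t]).card := by
      simp only [degree, Finset.card_filter]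
      exact Finset.sum_comm
    _ ≤ ∑ t : Fin σ.length, if ∃ s ∈ T, s ∈ σ[t] then d else 0 := by
      refine Finset.sum_le_sum fun t _ => ?_
      split_ifs with h
      · refine (Finset.card_le_card fun s hs => ?_).trans (hσ.2 σ[t] (List.getElem_mem t.2))
        exact (Finset.mem_filter.1 hs).2
      · rw [Nat.le_zero, Finset.card_eq_zero, Finset.filter_eq_empty_iff]
        exact fun s hs hst => h ⟨s, hs, hst⟩
    _ = _ := by
      rw [← Finset.sum_filter, Finset.sum_const, smul_eq_mul, mul_comm]

/-- Hall's theorem for the graph with `b s` copies of each server; counting edges at a set of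
servers gives Hall's condition because d ≤ k. -/
theorem sum_le_opt [Fintype S] {k d : ℕ} (hk : 1 ≤ k) (hdk : d ≤ k) {b : S → ℕ}
    {σ : List (Finset S)} (hσ : IsKDGraph k d b σ) : ∑ s, b s ≤ opt b σ := by
  classical
  let nb : (Σ s, Fin (b s)) → Finset (Fin σ.length) := fun x =>
    Finset.univ.filter fun t => x.1 ∈ σ[t]
  have hall : ∀ C : Finset (Σ s, Fin (b s)), C.card ≤ (C.biUnion nb).card := by
    intro C
    have h1 : C.card ≤ ∑ s ∈ C.image Sigma.fst, b s := by
      calc C.card ≤ ((C.image Sigma.fst).sigma fun s => (Finset.univ : Finset (Fin (b s)))).card :=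
            Finset.card_le_card fun x hx =>
              Finset.mem_sigma.2 ⟨Finset.mem_image_of_mem _ hx, Finset.mem_univ _⟩
        _ = _ := by simp [Finset.card_sigma]
    have h2 := mul_sum_le_mul_card_of_isKDGraph hσ (C.image Sigma.fst)
    have h3 : (Finset.univ.filter fun t : Fin σ.length =>
        ∃ s ∈ C.image Sigma.fst, s ∈ σ[t]) ⊆ C.biUnion nb := by
      intro t ht
      obtain ⟨s, hs, hst⟩ := (Finset.mem_filter.1 ht).2
      obtain ⟨x, hx, rfl⟩ := Finset.mem_image.1 hs
      exact Finset.mem_biUnion.2 ⟨x, hx, Finset.mem_filter.2 ⟨Finset.mem_univ _, hst⟩⟩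
    refine h1.trans (Nat.le_of_mul_le_mul_left ?_ hk)
    exact h2.trans (Nat.mul_le_mul hdk (Finset.card_le_card h3))
  obtain ⟨f, hf, hfn⟩ := (Finset.all_card_le_biUnion_card_iff_exists_injective nb).1 hall
  let g : (Σ s, Fin (b s)) → S × Fin σ.length := fun x => (x.1, f x)
  have hg : Function.Injective g := fun x y h => hf (congrArg Prod.snd h)
  have hM : IsBMatching b σ (Finset.univ.image g) := by
    refine ⟨fun e he => ?_, fun s => ?_, fun t => Finset.card_le_one.2 fun e he e' he' => ?_⟩
    · obtain ⟨x, -, rfl⟩ := Finset.mem_image.1 he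
      exact (Finset.mem_filter.1 (hfn x)).2
    · calc _ ≤ ((Finset.univ : Finset (Fin (b s))).image fun i => g ⟨s, i⟩).card := by
            refine Finset.card_le_card fun e he => ?_
            obtain ⟨heM, rfl⟩ := Finset.mem_filter.1 he
            obtain ⟨⟨s, i⟩, -, rfl⟩ := Finset.mem_image.1 heM
            exact Finset.mem_image.2 ⟨i, Finset.mem_univ _, rfl⟩
        _ ≤ b s := Finset.card_image_le.trans (by simp)
    · obtain ⟨heM, rfl⟩ := Finset.mem_filter.1 he
      obtain ⟨heM', h⟩ := Finset.mem_filter.1 he'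
      obtain ⟨x, -, rfl⟩ := Finset.mem_image.1 heM
      obtain ⟨y, -, rfl⟩ := Finset.mem_image.1 heM'
      rw [hf h]
  calc ∑ s, b s = (Finset.univ.image g).card := by
        rw [Finset.card_image_of_injective _ hg]
        simp [Fintype.card_sigma]
    _ ≤ opt b σ := by
        unfold opt
        refine Finset.le_sup (f := Finset.card) ?_
        rw [Finset.mem_filter]
        exact ⟨Finset.mem_univ _, hM⟩

end MaximumMatching

/-! ### The adversary -/

section Adversary

variable {S : Type*} [DecidableEq S]

/-- Requests of degree one that raise the degrees of the servers in `U` to at least `f`. -/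
theorem exists_private_requests (f : S → ℕ) (U : Finset S) :
    ∃ τ : List (Finset S), (∀ N ∈ τ, N.card ≤ 1) ∧ (∀ s ∈ U, f s ≤ degree τ s) ∧
      ∀ s ∉ U, ∀ N ∈ τ, s ∉ N := by
  induction U using Finset.induction_on with
  | empty => exact ⟨[], by simp⟩
  | insert s U hs ih =>
    obtain ⟨τ, h1, h2, h3⟩ := ih
    have hdeg : ∀ m, degree (List.replicate m {s}) s = m := by
      intro m
      induction m with
      | zero => simp [degree_nil]
      | succ m ihm => rw [List.replicate_succ', degree_append_singleton, ihm]; simp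
    refine ⟨τ ++ List.replicate (f s) {s}, ?_, ?_, ?_⟩
    · intro N hN
      rcases List.mem_append.1 hN with h | h
      · exact h1 N h
      · rw [List.eq_of_mem_replicate h, Finset.card_singleton]
    · intro u hu
      rw [degree_append]
      rcases Finset.mem_insert.1 hu with rfl | hu
      · rw [hdeg]
        omega
      · exact (h2 u hu).trans (Nat.le_add_right _ _)
    · intro u hu N hN
      rw [Finset.mem_insert, not_or] at hu
      rcases List.mem_append.1 hN with h | h
      · exact h3 u hu.2 N h
      · rw [List.eq_of_mem_replicate h, Finset.mem_singleton]
        exact hu.1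

/-- The rule `A` selects a neighbour with remaining capacity whenever all requests so far have
degree at most `d`. -/
def IsFeasible (d : ℕ) (b : S → ℕ) (A : OnlineRule S) : Prop :=
  ∀ (σ : List (Finset S)) (N : Finset S), (∀ M ∈ σ, M.card ≤ d) → N.card ≤ d →
    ∀ s, A σ N = some s → s ∈ N ∧ A.load σ s < b s

/-- Any prefix of requests of degree at most d extends by degree-one requests to a (k,d)-graph, and
the output there contains the choices already made. -/
theorem IsFeasible.of_isBMatching [Fintype S] {k d : ℕ} (hd : 1 ≤ d) {b : S → ℕ}
    {A : OnlineRule S} (hA : ∀ σ, IsKDGraph k d b σ → IsBMatching b σ (A.output σ)) :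
    IsFeasible d b A := by
  intro σ N hσ hN s hs
  obtain ⟨τ, h1, h2, -⟩ := exists_private_requests (fun s => k * b s) (Finset.univ : Finset S)
  have hlen : σ.length < ((σ ++ [N]) ++ τ).length := by simp
  have hM := hA ((σ ++ [N]) ++ τ) ⟨fun s => ?_, fun M hM => ?_⟩
  · have hmem : (s, (⟨σ.length, hlen⟩ : Fin ((σ ++ [N]) ++ τ).length)) ∈
        A.output ((σ ++ [N]) ++ τ) := by
      simp [OnlineRule.output, hs]
    refine ⟨by simpa using hM.1 _ hmem, ?_⟩
    have h3 := hM.2.1 s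
    rw [card_output_filter_fst] at h3
    have h4 := load_le_load_append A (σ ++ [N]) τ s
    rw [load_append_singleton, if_pos hs] at h4
    omega
  · rw [degree_append]
    exact (h2 s (Finset.mem_univ s)).trans (Nat.le_add_left _ _)
  · simp only [List.mem_append, List.mem_singleton] at hM
    rcases hM with (hM | rfl) | hM
    · exact hσ M hM
    · exact hN
    · exact (h1 M hM).trans hd

variable {d : ℕ} {b : S → ℕ} {A : OnlineRule S}

theorem IsFeasible.load_le (hA : IsFeasible d b A) (σ : List (Finset S))
    (hσ : ∀ N ∈ σ, N.card ≤ d) (s : S) : A.load σ s ≤ b s := by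
  induction σ using List.reverseRecOn with
  | nil => simp [load_nil]
  | append_singleton σ N ih =>
    have h1 : ∀ M ∈ σ, M.card ≤ d := fun M hM => hσ M (by simp [hM])
    rw [load_append_singleton]
    split_ifs with h
    · exact (hA σ N h1 (hσ N (by simp)) s h).2
    · exact ih h1

theorem IsFeasible.load_append (hA : IsFeasible d b A) (σ τ : List (Finset S))
    (hσ : ∀ N ∈ σ ++ τ, N.card ≤ d) {s : S} (hs : ∀ N ∈ τ, s ∉ N) :
    A.load (σ ++ τ) s = A.load σ s := by
  induction τ using List.reverseRecOn with
  | nil => simp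
  | append_singleton τ N ih =>
    rw [← List.append_assoc] at hσ ⊢
    have h1 : ∀ M ∈ σ ++ τ, M.card ≤ d := fun M hM => hσ M (List.mem_append_left _ hM)
    rw [load_append_singleton, ih h1 fun M hM => hs M (List.mem_append_left _ hM),
      if_neg fun h => hs N (by simp) (hA _ N h1 (hσ N (by simp)) s h).1, add_zero]

variable [Fintype S]

/-- The load of the servers after the requests `σ` plus a bound on the number of requests they can
still be matched to. -/
noncomputable def adversaryPotential (k d : ℕ) (b : S → ℕ) (A : OnlineRule S)
    (σ : List (Finset S)) : ℝ :=
  ∑ s, ((A.load σ s : ℝ) + gain d (b s - A.load σ s) (k * b s - degree σ s))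

/-- If one of the d equal servers is matched, `gain_succ_succ` says that the changes cancel exactly;
if none is, every gain only loses a trial. -/
theorem adversaryPotential_append_le {k : ℕ} (hd : 2 ≤ d) (hA : IsFeasible d b A)
    {σ : List (Finset S)} (hσ : ∀ N ∈ σ, N.card ≤ d) {T : Finset S} (hT : T.card = d)
    {β l δ : ℕ} (hδ : δ < k * β) (hb : ∀ s ∈ T, b s = β) (hl : ∀ s ∈ T, A.load σ s = l)
    (hdeg : ∀ s ∈ T, degree σ s = δ) :
    adversaryPotential k d b A (σ ++ [T]) ≤ adversaryPotential k d b A σ := by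
  obtain ⟨n, hn⟩ : ∃ n, k * β - δ = n + 1 := ⟨k * β - δ - 1, by omega⟩
  have hterm : ∀ s, (A.load (σ ++ [T]) s : ℝ) +
      gain d (b s - A.load (σ ++ [T]) s) (k * b s - degree (σ ++ [T]) s) ≤
      ((A.load σ s : ℝ) + gain d (b s - A.load σ s) (k * b s - degree σ s)) +
        ((if s ∈ T then gain d (β - l) n - gain d (β - l) (n + 1) else 0) +
          if A σ T = some s then 1 + gain d (β - (l + 1)) n - gain d (β - l) n else 0) := by
    intro s
    rw [load_append_singleton, degree_append_singleton]
    by_cases hs : s ∈ T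
    · rw [hb s hs, hl s hs, hdeg s hs, if_pos hs, if_pos hs, hn, show k * β - (δ + 1) = n by omega]
      split_ifs with h
      · push_cast
        linarith
      · simp
    · have h : A σ T ≠ some s := fun h => hs (hA σ T hσ hT.le s h).1
      simp [hs, h]
  refine (Finset.sum_le_sum fun s _ => hterm s).trans ?_
  rw [Finset.sum_add_distrib]
  refine add_le_of_nonpos_right ?_
  rw [Finset.sum_add_distrib, ← Finset.sum_filter, Finset.filter_mem_eq_inter, Finset.univ_inter,
    Finset.sum_const, hT, nsmul_eq_mul]
  have hle := gain_le_succ_right hd (β - l) n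
  have hd0 : (0 : ℝ) ≤ d := Nat.cast_nonneg d
  rcases h : A σ T with _ | s₀
  · simp only [reduceCtorEq, if_false, Finset.sum_const_zero, add_zero]
    exact mul_nonpos_of_nonneg_of_nonpos hd0 (by linarith)
  · obtain ⟨hs, hlt⟩ := hA σ T hσ hT.le s₀ h
    rw [hl _ hs, hb _ hs] at hlt
    obtain ⟨m, hm⟩ : ∃ m, β - l = m + 1 := ⟨β - l - 1, by omega⟩
    simp only [Option.some.injEq, Finset.sum_ite_eq, Finset.mem_univ, if_true]
    rw [hm, show β - (l + 1) = m by omega]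
    have := gain_succ_succ hd m n
    linarith

/-- The adversary requests `d` servers in the same state of incomplete degree as long as there are
any. -/
theorem exists_exhausted_requests (k : ℕ) (hd : 2 ≤ d) (hA : IsFeasible d b A)
    (σ : List (Finset S)) (hσ : ∀ N ∈ σ, N.card ≤ d) :
    ∃ σ' : List (Finset S), (∀ N ∈ σ', N.card ≤ d) ∧
      adversaryPotential k d b A σ' ≤ adversaryPotential k d b A σ ∧
      ∀ x : ℕ × ℕ × ℕ, (Finset.univ.filter fun s => degree σ' s < k * b s ∧
        (b s, A.load σ' s, degree σ' s) = x).card < d := by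
  -- Each request to servers of incomplete degree lowers the total missing degree.
  induction hm : ∑ s, (k * b s - degree σ s) using Nat.strong_induction_on generalizing σ with
  | _ m ih =>
    by_cases h : ∀ x : ℕ × ℕ × ℕ, (Finset.univ.filter fun s => degree σ s < k * b s ∧
        (b s, A.load σ s, degree σ s) = x).card < d
    · exact ⟨σ, hσ, le_rfl, h⟩
    push Not at h
    obtain ⟨⟨β, l, δ⟩, h⟩ := h
    obtain ⟨T, hTs, hT⟩ := Finset.exists_subset_card_eq h
    have hT' : ∀ s ∈ T, degree σ s < k * b s ∧ b s = β ∧ A.load σ s = l ∧ degree σ s = δ := by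
      intro s hs
      simpa using (Finset.mem_filter.1 (hTs hs)).2
    obtain ⟨s₀, hs₀⟩ : T.Nonempty := Finset.card_pos.1 (by omega)
    have hδ : δ < k * β := by
      obtain ⟨h1, h2, -, h4⟩ := hT' s₀ hs₀
      rwa [h2, h4] at h1
    have hσ' : ∀ N ∈ σ ++ [T], N.card ≤ d := by
      intro N hN
      rcases List.mem_append.1 hN with hN | hN
      · exact hσ N hN
      · rw [List.mem_singleton.1 hN, hT]
    have hlt : ∑ s, (k * b s - degree (σ ++ [T]) s) < m := by
      rw [← hm]
      refine Finset.sum_lt_sum (fun s _ => ?_) ⟨s₀, Finset.mem_univ _, ?_⟩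
      · rw [degree_append_singleton]
        omega
      · have := (hT' s₀ hs₀).1
        rw [degree_append_singleton, if_pos hs₀]
        omega
    obtain ⟨σ', h1, h2, h3⟩ := ih _ hlt (σ ++ [T]) hσ' rfl
    exact ⟨σ', h1, h2.trans (adversaryPotential_append_le hd hA hσ hT hδ
      (fun s hs => (hT' s hs).2.1) (fun s hs => (hT' s hs).2.2.1)
      (fun s hs => (hT' s hs).2.2.2)), h3⟩

/-- For capacities at most `β`, the adversary keeps the output below the sum of the values `gain`,
up to an error that does not depend on the number of servers. -/
theorem exists_isKDGraph_card_output_le {k : ℕ} (hd : 2 ≤ d) (hA : IsFeasible d b A) {β : ℕ}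
    (hβ : ∀ s, b s ≤ β) :
    ∃ σ : List (Finset S), IsKDGraph k d b σ ∧
      ((A.output σ).card : ℝ) ≤ ∑ s, gain d (b s) (k * b s) +
        (((β + 1) * ((β + 1) * (k * β + 1)) * d * β : ℕ) : ℝ) := by
  obtain ⟨σ, hσ, hpot, hfew⟩ := exists_exhausted_requests k hd hA [] (by simp)
  set U : Finset S := Finset.univ.filter fun s => degree σ s < k * b s with hU
  have hmemU : ∀ s, s ∈ U ↔ degree σ s < k * b s := fun s => by simp [hU]
  obtain ⟨τ, h1, h2, h3⟩ := exists_private_requests (fun s => k * b s) U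
  have hστ : ∀ N ∈ σ ++ τ, N.card ≤ d := by
    intro N hN
    rcases List.mem_append.1 hN with hN | hN
    · exact hσ N hN
    · exact (h1 N hN).trans (by omega)
  refine ⟨σ ++ τ, ⟨fun s => ?_, hστ⟩, ?_⟩
  · rw [degree_append]
    by_cases hs : s ∈ U
    · exact (h2 s hs).trans (Nat.le_add_left _ _)
    · rw [hmemU, not_lt] at hs
      exact hs.trans (Nat.le_add_right _ _)
  -- Fewer than d unfinished servers share a state (capacity, load, degree), and the number of
  -- states depends only on k and β.
  have hUcard : U.card ≤ (β + 1) * ((β + 1) * (k * β + 1)) * d := by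
    have h := Finset.card_le_mul_card_image_of_maps_to
      (s := U) (f := fun s => (b s, A.load σ s, degree σ s))
      (t := Finset.range (β + 1) ×ˢ Finset.range (β + 1) ×ˢ Finset.range (k * β + 1))
      (fun s hs => by
        have hs := (hmemU s).1 hs
        have e1 := hβ s
        have e2 := hA.load_le σ hσ s
        have e3 := Nat.mul_le_mul_left k e1
        simp only [Finset.mem_product, Finset.mem_range]
        omega) d (fun x _ => by
          rw [hU, Finset.filter_filter]
          exact (hfew x).le)
    rw [Finset.card_product, Finset.card_product] at h
    simp only [Finset.card_range] at h
    rwa [mul_comm d] at h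
  -- Only unfinished servers receive private requests, and each ends with load at most β.
  have hload : ∀ s, (A.load (σ ++ τ) s : ℝ) ≤
      ((A.load σ s : ℝ) + gain d (b s - A.load σ s) (k * b s - degree σ s)) +
        if s ∈ U then (β : ℝ) else 0 := by
    intro s
    have hg := gain_nonneg hd (b s - A.load σ s) (k * b s - degree σ s)
    split_ifs with hs
    · have : (A.load (σ ++ τ) s : ℝ) ≤ β := by
        exact_mod_cast (hA.load_le (σ ++ τ) hστ s).trans (hβ s)
      have : (0 : ℝ) ≤ A.load σ s := Nat.cast_nonneg _
      linarith
    · rw [hA.load_append σ τ hστ (h3 s hs)]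
      linarith
  have hnil : adversaryPotential k d b A [] = ∑ s, gain d (b s) (k * b s) := by
    simp [adversaryPotential, load_nil, degree_nil]
  rw [card_output, Nat.cast_sum, ← hnil]
  refine (Finset.sum_le_sum fun s _ => hload s).trans ?_
  rw [Finset.sum_add_distrib, ← Finset.sum_filter, Finset.filter_mem_eq_inter, Finset.univ_inter,
    Finset.sum_const, nsmul_eq_mul]
  refine add_le_add hpot ?_
  exact_mod_cast Nat.mul_le_mul_right β hUcard

end Adversary

theorem le_cStar_min' {k d : ℕ} (hk : 1 ≤ k) (hd : 2 ≤ d) (hdk : d ≤ k) {B : Finset ℕ}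
    (hB : B.Nonempty) (hpos : ∀ β ∈ B, 0 < β) {A : OnlineAlgorithm} (hA : A.IsValid k d) {c : ℝ}
    (hc : A.IsCompetitiveOn k d B c) : c ≤ cStar k d (B.min' hB) := by
  set β := B.min' hB with hβ
  have hβB : β ∈ B := B.min'_mem hB
  have hβ0 : (0 : ℝ) < β := by exact_mod_cast hpos β hβB
  set E := (B.max' hB + 1) * ((B.max' hB + 1) * (k * B.max' hB + 1)) * d * B.max' hB with hE
  have main : ∀ N : ℕ, (N : ℝ) * ((c - cStar k d β) * β) ≤
      (E : ℝ) + ∑ i, gain d (B.orderEmbOfFin rfl i) (k * B.orderEmbOfFin rfl i) -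
        c * ∑ i, ((B.orderEmbOfFin rfl i : ℕ) : ℝ) := by
    intro N
    -- One server of each capacity in B makes the capacity set right; N further servers of least
    -- capacity dominate as N grows, while E is independent of N.
    let b : Fin (B.card + N) → ℕ := Fin.append (fun i => B.orderEmbOfFin rfl i) fun _ => β
    have hmem : ∀ s, b s ∈ B := fun s => by
      refine Fin.addCases (fun i => ?_) (fun i => ?_) s
      · simp only [b, Fin.append_left]
        exact B.orderEmbOfFin_mem rfl i
      · simpa only [b, Fin.append_right] using hβB
    have himage : Finset.univ.image b = B := by
      refine Finset.Subset.antisymm (Finset.image_subset_iff.2 fun s _ => hmem s) fun x hx => ?_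
      have hx' : x ∈ Set.range (B.orderEmbOfFin rfl) := by
        rwa [Finset.range_orderEmbOfFin]
      obtain ⟨i, rfl⟩ := hx'
      exact Finset.mem_image.2 ⟨Fin.castAdd N i, Finset.mem_univ _, by simp [b]⟩
    have hfeas : IsFeasible d b (A _ b) :=
      IsFeasible.of_isBMatching (by omega) (hA _ b fun s => hpos _ (hmem s))
    obtain ⟨σ, hσ, hout⟩ := exists_isKDGraph_card_output_le (k := k)
      (β := B.max' hB) hd hfeas
      (fun s => B.le_max' _ (hmem s))
    have h := hc _ b himage σ hσ
    rw [le_antisymm (opt_le_sum b σ) (sum_le_opt hk hdk hσ)] at h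
    have h := h.trans hout
    rw [← hE, Nat.cast_sum, Fin.sum_univ_add, Fin.sum_univ_add] at h
    simp only [b, Fin.append_left, Fin.append_right, Finset.sum_const, Finset.card_univ,
      Fintype.card_fin, nsmul_eq_mul, ← mul_cStar k d (hpos β hβB)] at h
    linarith
  by_contra! hlt
  have hx : 0 < (c - cStar k d β) * β := mul_pos (by linarith) hβ0
  obtain ⟨N, hN⟩ := exists_nat_gt (((E : ℝ) +
    ∑ i, gain d (B.orderEmbOfFin rfl i) (k * B.orderEmbOfFin rfl i) -
      c * ∑ i, ((B.orderEmbOfFin rfl i : ℕ) : ℝ)) / ((c - cStar k d β) * β))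
  rw [div_lt_iff₀ hx] at hN
  exact absurd (main N) (not_le.2 hN)

end KDMatching

theorem mainTheorem4 (k d : ℕ) (hk : 1 ≤ k) (hd : 2 ≤ d) :
    -- the algorithm exists
    (∃ A : KDMatching.OnlineAlgorithm, KDMatching.IsWeightedAssignmentVC k d A) ∧
    -- however ties are broken, it outputs `b`-matchings and is `min_s c*_s`-competitive
    (∀ A : KDMatching.OnlineAlgorithm, KDMatching.IsWeightedAssignmentVC k d A →
      A.IsValid k d ∧
      ∀ (n : ℕ) [NeZero n] (b : Fin n → ℕ), (∀ s, 0 < b s) →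
        ∀ σ : List (Finset (Fin n)), KDMatching.IsKDGraph k d b σ →
          (Finset.univ.inf' Finset.univ_nonempty fun s => KDMatching.cStar k d (b s)) *
              (KDMatching.opt b σ : ℝ) ≤
            (((A n b).output σ).card : ℝ)) ∧
    -- this ratio is `c*` for the smallest capacity
    (∀ (n : ℕ) [NeZero n] (b : Fin n → ℕ), (∀ s, 0 < b s) →
      (Finset.univ.inf' Finset.univ_nonempty fun s => KDMatching.cStar k d (b s)) =
        KDMatching.cStar k d (Finset.univ.inf' Finset.univ_nonempty b)) ∧
    -- optimality: for no set of capacities does a deterministic online algorithm do better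
    (d ≤ k →
      ∀ (B : Finset ℕ) (hB : B.Nonempty), (∀ β ∈ B, 0 < β) →
        ∀ A : KDMatching.OnlineAlgorithm, A.IsValid k d →
          ∀ c : ℝ, A.IsCompetitiveOn k d B c → c ≤ KDMatching.cStar k d (B.min' hB)) := by
  refine ⟨KDMatching.exists_isWeightedAssignmentVC k d, fun A hA => ⟨hA.isValid, ?_⟩, ?_, ?_⟩
  · intro n _ b hb σ hσ
    exact hA.competitive b hk hd hb hσ
  · intro n _ b hb
    exact KDMatching.inf'_cStar hk hd b hb
  · intro hdk B hB hpos A hA c hc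
    exact KDMatching.le_cStar_min' hk hd hdk hB hpos hA hc
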